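/- Theorem (supermodularity of the value function). Let $S\subseteq\mathbb{R}^{n}$ (states) and $A\subseteq\mathbb{R}^{k}$ (actions) be lattices under the componentwise order, with $x\vee y$ and $x\wedge y$ the coordinatewise maximum and minimum, and equip them with the Euclidean topology and the Borel $\sigma$-algebra. Let $\Gamma:S\to 2^{A}$ be a correspondence, $p$ a transition probability function from $S\times A$ to $S$ (that is, $p(s,a,\cdot)$ is a probability measure on $S$ for each $(s,a)$, and $p(\cdot,\cdot,B)$ is measurable for each Borel $B\subseteq S$), $r:S\times A\to\mathbb{R}$ a payoff function and $0<\beta<1$ a discount factor. A strategy $\sigma=(\sigma_t)_{t\ge 1}$ is a sequence of Borel measurable maps $\sigma_t:S\times(A\times S)^{t-1}\to A$ with $\sigma_t(s(1),a(1),\ldots,s(t))\in\Gamma(s(t))$ for every history; together with $p$ and an initial state $s(1)=s$ it induces a probability law of the process $(s(t),a(t))_{t\ge1}$, with expectation $\mathbb{E}_{\sigma}$, and the value function is $$V(s)=\sup_{\sigma}\ \mathbb{E}_{\sigma}\sum_{t=1}^{\infty}\beta^{t-1}r(s(t),a(t)),\qquad s\in S .$$ Assume that: 1. $r$ is bounded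 and upper semicontinuous on $S\times A$; for each bounded upper semicontinuous $f:S\to\mathbb{R}$ the function $(s,a)\mapsto\int_S f(s')\,p(s,a,ds')$ is bounded and upper semicontinuous on $S\times A$; $\Gamma(s)$ is non-empty and compact for each $s\in S$; and $\Gamma$ is upper semicontinuous, i.e. $\{s\in S:\Gamma(s)\subseteq U\}$ is open for each open $U\subseteq A$. 2. $r$ is supermodular on $S\times A$, where a real function $g$ on a lattice $X$ is called supermodular if $g(x)+g(x')\le g(x\vee x')+g(x\wedge x')$ for all $x,x'\in X$, and $S\times A$ carries the componentwise order. 3. $p$ is supermodular: $(s,a)\mapsto\int_S f(s')\,p(s,a,ds')$ is supermodular on $S\times A$ for each bounded measurable supermodular $f:S\to\mathbb{R}$. 4. $\Gamma$ is supermodular: if $a'\in\Gamma(s')$ and $a''\in\Gamma(s'')$, then $a'\vee a''\in\Gamma(s'\vee s'')$ and $a'\wedge a''\in\Gamma(s'\wedge s'')$; in other words, the graph of $\Gamma$ is a sublattice of $S\times A$. Then $V$ is well defined (for each $s$ it is the supremum of a non-empty bounded set of real numbers) and $V$ is supermodular on $S$. -/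

import Mathlib

open MeasureTheory ProbabilityTheory

namespace DynProg

/-- A real function on a lattice is supermodular. -/
def IsSupermodular {X : Type*} [Lattice X] (f : X → ℝ) : Prop :=
  ∀ x y : X, f x + f y ≤ f (x ⊔ y) + f (x ⊓ y)

/-- A real function is bounded (in absolute value). -/
def IsBoundedFun {X : Type*} (f : X → ℝ) : Prop :=
  ∃ M : ℝ, ∀ x, |f x| ≤ M

/-- The correspondence `Γ` is supermodular, i.e. its graph is closed under the componentwise
joins and meets of `S × A`. -/
def IsSupermodularCorrespondence {S A : Type*} [Lattice S] [Lattice A] (Γ : S → Set A) :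
    Prop :=
  ∀ s' s'' : S, ∀ a' ∈ Γ s', ∀ a'' ∈ Γ s'', a' ⊔ a'' ∈ Γ (s' ⊔ s'') ∧ a' ⊓ a'' ∈ Γ (s' ⊓ s'')

section Transition

variable {S A : Type*} [MeasurableSpace S] [MeasurableSpace A]

/-- The transition kernel `p` is upper semicontinuous: `(s, a) ↦ ∫ f(s') p(s, a, ds')` is u.s.c.
and bounded whenever `f` is. -/
def IsUSCKernel [TopologicalSpace S] [TopologicalSpace A] (p : Kernel (S × A) S) : Prop :=
  ∀ f : S → ℝ, UpperSemicontinuous f → IsBoundedFun f →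
    UpperSemicontinuous (fun x : S × A => ∫ s', f s' ∂(p x)) ∧
      IsBoundedFun (fun x : S × A => ∫ s', f s' ∂(p x))

/-- The transition kernel `p` is supermodular: `(s, a) ↦ ∫ f(s') p(s, a, ds')` is supermodular
whenever `f` is (`f` bounded and measurable, so that all the integrals exist). -/
def IsSupermodularKernel [Lattice S] [Lattice A] (p : Kernel (S × A) S) : Prop :=
  ∀ f : S → ℝ, Measurable f → IsBoundedFun f → IsSupermodular f →
    IsSupermodular (fun x : S × A => ∫ s', f s' ∂(p x))

end Transition

/-- Histories up to and including the state of period `t` (periods are numbered from `0`):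
the state-action pairs of the periods `0, …, t - 1`, together with the state of period `t`. -/
abbrev History (S A : Type*) (t : ℕ) : Type _ := (Fin t → S × A) × S

variable {S A : Type*} [MeasurableSpace S] [MeasurableSpace A]

/-- A strategy: for each period a measurable choice of a feasible action as a function of the
history up to that period. -/
structure Strategy (Γ : S → Set A) where
  /-- The action chosen in period `t` after a given history. -/
  act : (t : ℕ) → History S A t → A
  measurable_act : ∀ t, Measurable (act t)
  feasible : ∀ (t : ℕ) (h : History S A t), act t h ∈ Γ h.2

variable {Γ : S → Set A}

/-- From the state-action pairs `x` of the periods `0, …, t` and the state `s'` of period `t + 1`,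
the state-action pair of period `t + 1` under the strategy `σ`. -/
def Strategy.nextPair (σ : Strategy Γ) (t : ℕ) (y : (Finset.Iic t → S × A) × S) : S × A :=
  (y.2, σ.act (t + 1)
    (fun i : Fin (t + 1) => y.1 ⟨i, Finset.mem_Iic.2 (Nat.lt_succ_iff.1 i.2)⟩, y.2))

theorem Strategy.measurable_nextPair (σ : Strategy Γ) (t : ℕ) : Measurable (σ.nextPair t) := by
  refine measurable_snd.prodMk ((σ.measurable_act (t + 1)).comp ?_)
  refine Measurable.prodMk (measurable_pi_lambda _ fun i => ?_) measurable_snd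
  exact (measurable_pi_apply _).comp measurable_fst

/-- The conditional law of the state-action pair of period `t + 1` given those of the periods
`0, …, t`: the new state is drawn from `p (s(t), a(t), ·)` and the new action is the one which the
strategy `σ` prescribes. -/
noncomputable def Strategy.stepKernel (p : Kernel (S × A) S) (σ : Strategy Γ) (t : ℕ) :
    Kernel (Finset.Iic t → S × A) (S × A) :=
  (Kernel.id ×ₖ p.comap (fun x : Finset.Iic t → S × A => x ⟨t, Finset.mem_Iic.2 le_rfl⟩)
    (measurable_pi_apply _)).map (σ.nextPair t)

instance Strategy.isMarkovKernel_stepKernel (p : Kernel (S × A) S) [IsMarkovKernel p]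
    (σ : Strategy Γ) (t : ℕ) : IsMarkovKernel (σ.stepKernel p t) :=
  Kernel.IsMarkovKernel.map _ (σ.measurable_nextPair t)

/-- The law on the space of infinite histories `(s(0), a(0), s(1), a(1), …)` that is induced by
the strategy `σ`, the transition kernel `p` and the initial state `s`. -/
noncomputable def Strategy.law (p : Kernel (S × A) S) [IsMarkovKernel p] (σ : Strategy Γ) (s : S) :
    Measure (ℕ → S × A) :=
  Kernel.traj (X := fun _ : ℕ => S × A) (fun t => σ.stepKernel p t) 0
    (fun _ => (s, σ.act 0 (Fin.elim0, s)))

/-- The expected discounted payoff of the strategy `σ` from the initial state `s`. -/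
noncomputable def Strategy.payoff (p : Kernel (S × A) S) [IsMarkovKernel p] (r : S × A → ℝ) (β : ℝ)
    (σ : Strategy Γ) (s : S) : ℝ :=
  ∫ ω, ∑' t : ℕ, β ^ t * r (ω t) ∂(σ.law p s)

/-- The value function: the supremum over all strategies of the expected discounted payoff. -/
noncomputable def valueFunction (Γ : S → Set A) (p : Kernel (S × A) S) [IsMarkovKernel p]
    (r : S × A → ℝ) (β : ℝ) (s : S) : ℝ :=
  ⨆ σ : Strategy Γ, σ.payoff p r β s

end DynProg

/-! The Bellman operator preserves bounded upper semicontinuous supermodular functions. The join and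
meet of maximizers at `s` and `t` are feasible at `s ⊔ t` and `s ⊓ t`, so supermodularity of
`lookahead` passes to its maximum (`IsSupermodularProgram.isRegular_bellman`). The operator
contracts by `β` and the class is closed under uniform limits, so iteration from `0` yields a fixed
point `v` in the class (`exists_isRegular_fixedPoint`).

It remains to identify `v` with the value function. By a telescoping sum, `v` bounds the payoff of
every strategy (`Strategy.payoff_le`). The bound is attained by a stationary strategy that plays a
measurable selection of the Bellman maximizers (`exists_measurable_selector`, `Strategy.le_payoff`).
-/

namespace DynProg

/-! ### Compact-valued correspondences and measurable selection -/

section Correspondence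

variable {S A : Type*} [TopologicalSpace S] [TopologicalSpace A]

/-- If the compact slice `{s} × Γ s` misses `C`, the tube lemma gives a product neighbourhood
missing `C`, and upper hemicontinuity keeps nearby slices inside it. This serves both measurability
of hitting sets and semicontinuity of the Bellman operator. -/
theorem isClosed_setOf_exists_mem {Γ : S → Set A} (hΓ : UpperHemicontinuous Γ)
    (hc : ∀ s, IsCompact (Γ s)) {C : Set (S × A)} (hC : IsClosed C) :
    IsClosed {s | ∃ a ∈ Γ s, (s, a) ∈ C} := by
  rw [← isOpen_compl_iff, isOpen_iff_mem_nhds]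
  intro s hs
  obtain ⟨U, V, hU, hV, hsU, hΓV, hUV⟩ := generalized_tube_lemma (isCompact_singleton (x := s))
    (hc s) hC.isOpen_compl (by
      rintro ⟨s', a⟩ ⟨rfl, ha⟩ h
      exact hs ⟨a, ha, h⟩)
  filter_upwards [hU.mem_nhds (hsU rfl), hΓ.forall_isOpen s V hV hΓV] with x hxU hxV
  rintro ⟨a, ha, h⟩
  exact hUV ⟨hxU, hxV ha⟩ h

/-- A correspondence with non-empty compact values whose hitting sets of closed subsets of the
graph space are measurable. -/
structure IsMeasurableCompact [MeasurableSpace S] (D : S → Set A) : Prop where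
  nonempty : ∀ s, (D s).Nonempty
  isCompact : ∀ s, IsCompact (D s)
  measurableSet_hit : ∀ C : Set (S × A), IsClosed C → MeasurableSet {s | ∃ a ∈ D s, (s, a) ∈ C}

theorem IsMeasurableCompact.of_upperHemicontinuous [MeasurableSpace S] [OpensMeasurableSpace S]
    {Γ : S → Set A} (hΓ : UpperHemicontinuous Γ) (hne : ∀ s, (Γ s).Nonempty)
    (hc : ∀ s, IsCompact (Γ s)) : IsMeasurableCompact Γ :=
  ⟨hne, hc, fun _ hC => (isClosed_setOf_exists_mem hΓ hc hC).measurableSet⟩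

/-- The maximizers of `u (s, ·)` on `D s`. -/
def argmax (D : S → Set A) (u : S × A → ℝ) (s : S) : Set A :=
  {a ∈ D s | ∀ b ∈ D s, u (s, b) ≤ u (s, a)}

theorem exists_mem_forall_le {D : Set A} {u : S × A → ℝ} (hu : UpperSemicontinuous u) (s : S)
    (hne : D.Nonempty) (hc : IsCompact D) : ∃ a ∈ D, ∀ b ∈ D, u (s, b) ≤ u (s, a) := by
  have h : UpperSemicontinuous fun a => u (s, a) := hu.comp (Continuous.prodMk_right s)
  obtain ⟨a, ha, hmax⟩ := (h.upperSemicontinuousOn D).exists_isMaxOn hne hc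
  exact ⟨a, ha, fun b hb => hmax hb⟩

theorem IsMeasurableCompact.argmax [MeasurableSpace S] {D : S → Set A}
    (hD : IsMeasurableCompact D) {u : S × A → ℝ} (hu : UpperSemicontinuous u) :
    IsMeasurableCompact (argmax D u) where
  nonempty s := exists_mem_forall_le hu s (hD.nonempty s) (hD.isCompact s)
  isCompact s := by
    obtain ⟨m, hm, hmax⟩ := exists_mem_forall_le hu s (hD.nonempty s) (hD.isCompact s)
    have hcl : IsClosed {a | u (s, m) ≤ u (s, a)} :=
      (hu.comp (Continuous.prodMk_right s)).isClosed_preimage (u (s, m))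
    convert (hD.isCompact s).inter_right hcl using 1
    ext a
    exact ⟨fun h => ⟨h.1, h.2 m hm⟩, fun h => ⟨h.1, fun b hb => (hmax b hb).trans h.2⟩⟩
  measurableSet_hit C hC := by
    have hcl (q : ℚ) : IsClosed {x : S × A | (q : ℝ) ≤ u x} := hu.isClosed_preimage (q : ℝ)
    -- A maximizer lies in `C` iff every rational level that `u` reaches on `D s` is also reached
    -- within `C`; only countably many hitting conditions are involved.
    have key : {s | ∃ a ∈ DynProg.argmax D u s, (s, a) ∈ C} = {s | ∃ a ∈ D s, (s, a) ∈ C} ∩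
        ⋂ q : ℚ, ({s | ∃ a ∈ D s, (s, a) ∈ {x : S × A | (q : ℝ) ≤ u x}}ᶜ ∪
          {s | ∃ a ∈ D s, (s, a) ∈ C ∩ {x : S × A | (q : ℝ) ≤ u x}}) := by
      ext s
      simp only [Set.mem_inter_iff, Set.mem_iInter, Set.mem_union, Set.mem_compl_iff,
        Set.mem_ofPred_eq]
      constructor
      · rintro ⟨a, ⟨ha, hmax⟩, haC⟩
        refine ⟨⟨a, ha, haC⟩, fun q => or_iff_not_imp_left.2 fun h => ?_⟩
        obtain ⟨b, hb, hqb⟩ := not_not.1 h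
        exact ⟨a, ha, haC, hqb.trans (hmax b hb)⟩
      · rintro ⟨⟨a₀, ha₀, ha₀C⟩, h⟩
        have hCs : IsClosed {a | (s, a) ∈ C} := hC.preimage (Continuous.prodMk_right s)
        obtain ⟨a, ha, hmax⟩ := exists_mem_forall_le (D := D s ∩ {a | (s, a) ∈ C}) hu s
          ⟨a₀, ha₀, ha₀C⟩ ((hD.isCompact s).inter_right hCs)
        refine ⟨a, ⟨ha.1, fun b hb => ?_⟩, ha.2⟩
        by_contra! hlt
        obtain ⟨q, hq₁, hq₂⟩ := exists_rat_btwn hlt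
        rcases h q with h | ⟨a', ha', ha'C, hqa'⟩
        · exact h ⟨b, hb, hq₂.le⟩
        · exact absurd (hqa'.trans (hmax a' ⟨ha', ha'C⟩)) (not_le.2 hq₁)
    rw [key]
    exact (hD.measurableSet_hit C hC).inter (MeasurableSet.iInter fun q =>
      (hD.measurableSet_hit _ (hcl q)).compl.union (hD.measurableSet_hit _ (hC.inter (hcl q))))

/-- Lexicographic maximization: passing to the maximizers of one `c i` after another makes each of
them constant on the remaining set. -/
theorem IsMeasurableCompact.exists_refinement [MeasurableSpace S] {D : S → Set A}
    (hD : IsMeasurableCompact D) {ι : Type*} {c : ι → A → ℝ} (hc : ∀ i, Continuous (c i))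
    (T : Finset ι) : ∃ D' : S → Set A, IsMeasurableCompact D' ∧ (∀ s, D' s ⊆ D s) ∧
      ∀ i ∈ T, ∀ s, ∀ a ∈ D' s, ∀ b ∈ D' s, c i a = c i b := by
  classical
  induction T using Finset.induction_on with
  | empty => exact ⟨D, hD, fun _ => subset_rfl, by simp⟩
  | insert j T _ ih =>
    obtain ⟨D', hD', hsub, hT⟩ := ih
    have hu : UpperSemicontinuous fun x : S × A => c j x.2 :=
      ((hc j).comp continuous_snd).upperSemicontinuous
    refine ⟨_, hD'.argmax hu, fun s a ha => hsub s ha.1, fun i hi s a ha b hb => ?_⟩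
    rcases Finset.mem_insert.1 hi with rfl | hi
    · exact le_antisymm (hb.2 a ha.1) (ha.2 b hb.1)
    · exact hT i hi s a ha.1 b hb.1

end Correspondence

/-- A measurable compact correspondence into a subset of `ℝᵏ` has a measurable selector. -/
theorem IsMeasurableCompact.exists_measurable_selector {S : Type*} [TopologicalSpace S]
    [MeasurableSpace S] {k : ℕ} {A : Sublattice (Fin k → ℝ)} {D : S → Set A}
    (hD : IsMeasurableCompact D) : ∃ f : S → A, Measurable f ∧ ∀ s, f s ∈ D s := by
  have hc (i : Fin k) : Continuous fun a : A => (a : Fin k → ℝ) i :=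
    (continuous_apply i).comp continuous_subtype_val
  -- Refining by all coordinates leaves one point in each `D' s`, so the choice is forced, and its
  -- coordinate superlevel sets are hitting sets of `D'`.
  obtain ⟨D', hD', hsub, hT⟩ := hD.exists_refinement hc Finset.univ
  choose f hf using hD'.nonempty
  refine ⟨f, Measurable.subtype_mk (f := fun s => (f s : Fin k → ℝ))
    (measurable_pi_lambda _ fun i => measurable_of_Ici fun x => ?_),
    fun s => hsub s (hf s)⟩
  have hcl : IsClosed {y : S × A | x ≤ (y.2 : Fin k → ℝ) i} :=
    isClosed_le continuous_const ((hc i).comp continuous_snd)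
  convert hD'.measurableSet_hit _ hcl using 1
  ext s
  constructor
  · exact fun h => ⟨f s, hf s, h⟩
  · rintro ⟨a, ha, h⟩
    have : x ≤ (a : Fin k → ℝ) i := h
    rwa [hT i (Finset.mem_univ i) s a ha (f s) (hf s)] at this

/-! ### The Bellman operator and its regular fixed point -/

section Bellman

variable {S A : Type*} [MeasurableSpace S] [MeasurableSpace A]

theorem integrable_of_isBoundedFun {X : Type*} [MeasurableSpace X] {μ : Measure X}
    [IsFiniteMeasure μ] {f : X → ℝ} (hf : Measurable f) (hb : IsBoundedFun f) :
    Integrable f μ := by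
  obtain ⟨M, hM⟩ := hb
  exact Integrable.of_bound hf.aestronglyMeasurable M (ae_of_all _ hM)

theorem abs_integral_le_of_abs_le {X : Type*} [MeasurableSpace X] {μ : Measure X}
    [IsProbabilityMeasure μ] {f : X → ℝ} {M : ℝ} (hM : ∀ x, |f x| ≤ M) : |∫ x, f x ∂μ| ≤ M := by
  have h : ∀ᵐ x ∂μ, ‖f x‖ ≤ M := ae_of_all _ hM
  simpa using norm_integral_le_of_norm_le_const h

/-- The payoff of the current pair plus the discounted expected value of the next state. -/
noncomputable def lookahead (p : Kernel (S × A) S) (r : S × A → ℝ) (β : ℝ) (v : S → ℝ)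
    (x : S × A) : ℝ :=
  r x + β * ∫ s', v s' ∂(p x)

/-- The Bellman operator. -/
noncomputable def bellman (Γ : S → Set A) (p : Kernel (S × A) S) (r : S × A → ℝ) (β : ℝ)
    (v : S → ℝ) (s : S) : ℝ :=
  sSup ((fun a => lookahead p r β v (s, a)) '' Γ s)

theorem bellman_eq {Γ : S → Set A} {p : Kernel (S × A) S} {r : S × A → ℝ} {β : ℝ}
    {v : S → ℝ} {s : S} {a : A} (ha : a ∈ argmax Γ (lookahead p r β v) s) :
    bellman Γ p r β v s = lookahead p r β v (s, a) :=
  IsGreatest.csSup_eq ⟨⟨a, ha.1, rfl⟩, by rintro _ ⟨b, hb, rfl⟩; exact ha.2 b hb⟩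

/-- Bounded upper semicontinuous supermodular functions. -/
structure IsRegular {S : Type*} [TopologicalSpace S] [Lattice S] (v : S → ℝ) : Prop where
  usc : UpperSemicontinuous v
  bounded : IsBoundedFun v
  supermodular : IsSupermodular v

theorem IsRegular.of_uniform_limit {S : Type*} [TopologicalSpace S]
    [Lattice S] {f : ℕ → S → ℝ} {v : S → ℝ} {b : ℕ → ℝ}
    (hf : ∀ n, IsRegular (f n)) (hb : Filter.Tendsto b Filter.atTop (nhds 0))
    (h : ∀ n s, |f n s - v s| ≤ b n) : IsRegular v where
  usc s y hy := by
    -- The error `b n` is spent twice, at `s` and at the nearby point, hence half the gap.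
    obtain ⟨n, hn⟩ := (hb.eventually (gt_mem_nhds (show (0 : ℝ) < (y - v s) / 2 by linarith))).exists
    have h₁ := abs_le.1 (h n s)
    filter_upwards [(hf n).usc s (y - b n) (by linarith)] with t ht
    have h₂ := abs_le.1 (h n t)
    linarith
  bounded := by
    obtain ⟨M, hM⟩ := (hf 0).bounded
    refine ⟨M + b 0, fun s => ?_⟩
    have h₁ := abs_le.1 (h 0 s)
    have h₂ := abs_le.1 (hM s)
    exact abs_le.2 ⟨by linarith, by linarith⟩
  supermodular s t := by
    have hlim (s : S) : Filter.Tendsto (fun n => f n s) Filter.atTop (nhds (v s)) :=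
      tendsto_iff_norm_sub_tendsto_zero.2
        (squeeze_zero (fun _ => norm_nonneg _) (fun n => h n s) hb)
    exact le_of_tendsto_of_tendsto' ((hlim s).add (hlim t)) ((hlim _).add (hlim _))
      fun n => (hf n).supermodular s t

theorem IsBoundedFun.measure_integral {X Y : Type*} [MeasurableSpace X] [MeasurableSpace Y]
    {κ : Kernel X Y} [IsMarkovKernel κ] {f : Y → ℝ} (hb : IsBoundedFun f) :
    IsBoundedFun fun x => ∫ y, f y ∂(κ x) :=
  hb.imp fun _ hM x => abs_integral_le_of_abs_le (μ := κ x) hM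

theorem IsBoundedFun.add_const_mul {X : Type*} {f g : X → ℝ} (hf : IsBoundedFun f)
    (hg : IsBoundedFun g) (c : ℝ) : IsBoundedFun fun x => f x + c * g x := by
  obtain ⟨M, hM⟩ := hf
  obtain ⟨N, hN⟩ := hg
  refine ⟨M + |c| * N, fun x => (abs_add_le _ _).trans (add_le_add (hM x) ?_)⟩
  rw [abs_mul]
  exact mul_le_mul_of_nonneg_left (hN x) (abs_nonneg c)

theorem IsBoundedFun.lookahead {p : Kernel (S × A) S} [IsMarkovKernel p] {r : S × A → ℝ} {β : ℝ}
    {v : S → ℝ} (hr : IsBoundedFun r) (hv : IsBoundedFun v) :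
    IsBoundedFun (lookahead p r β v) :=
  hr.add_const_mul hv.measure_integral β

theorem abs_lookahead_sub_le {p : Kernel (S × A) S} [IsMarkovKernel p] {r : S × A → ℝ} {β : ℝ}
    (hβ : 0 ≤ β) {v w : S → ℝ} (hvm : Measurable v) (hwm : Measurable w) (hv : IsBoundedFun v)
    (hw : IsBoundedFun w) {K : ℝ} (hK : ∀ s, |v s - w s| ≤ K) (x : S × A) :
    |lookahead p r β v x - lookahead p r β w x| ≤ β * K := by
  have h : lookahead p r β v x - lookahead p r β w x = β * ∫ s', (v s' - w s') ∂(p x) := by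
    rw [integral_sub (integrable_of_isBoundedFun hvm hv) (integrable_of_isBoundedFun hwm hw)]
    unfold lookahead
    ring
  rw [h, abs_mul, abs_of_nonneg hβ]
  refine mul_le_mul_of_nonneg_left ?_ hβ
  exact abs_integral_le_of_abs_le hK

variable [TopologicalSpace S] [TopologicalSpace A] {Γ : S → Set A} {p : Kernel (S × A) S}
  {r : S × A → ℝ} {β : ℝ}

theorem upperSemicontinuous_lookahead (hβ : 0 ≤ β) (hr : UpperSemicontinuous r)
    (hp : IsUSCKernel p) {v : S → ℝ} (hv : UpperSemicontinuous v) (hb : IsBoundedFun v) :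
    UpperSemicontinuous (lookahead p r β v) := by
  refine hr.add ?_
  exact (continuous_const_mul β).comp_upperSemicontinuous (hp v hv hb).1
    (monotone_mul_left_of_nonneg hβ)

/-- The data of the dynamic program satisfy the hypotheses of the supermodularity theorem. -/
structure IsSupermodularProgram [Lattice S] [Lattice A] (Γ : S → Set A) (p : Kernel (S × A) S)
    (r : S × A → ℝ) (β : ℝ) : Prop where
  pos : 0 < β
  lt_one : β < 1
  bounded : IsBoundedFun r
  usc : UpperSemicontinuous r
  usc_kernel : IsUSCKernel p
  uhc : UpperHemicontinuous Γ
  nonempty : ∀ s, (Γ s).Nonempty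
  isCompact : ∀ s, IsCompact (Γ s)
  supermodular : IsSupermodular r
  supermodular_kernel : IsSupermodularKernel p
  supermodular_corr : IsSupermodularCorrespondence Γ

namespace IsSupermodularProgram

variable [IsMarkovKernel p] [Lattice S] [Lattice A]

omit [IsMarkovKernel p] in
theorem argmax_nonempty (h : IsSupermodularProgram Γ p r β) {v : S → ℝ}
    (hv : UpperSemicontinuous v) (hb : IsBoundedFun v) (s : S) :
    (argmax Γ (lookahead p r β v) s).Nonempty :=
  exists_mem_forall_le (upperSemicontinuous_lookahead h.pos.le h.usc h.usc_kernel hv hb) s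
    (h.nonempty s) (h.isCompact s)

theorem abs_bellman_sub_le (h : IsSupermodularProgram Γ p r β) [OpensMeasurableSpace S]
    {v w : S → ℝ} (hv : UpperSemicontinuous v) (hw : UpperSemicontinuous w)
    (hvb : IsBoundedFun v) (hwb : IsBoundedFun w) {K : ℝ} (hK : ∀ s, |v s - w s| ≤ K) (s : S) :
    |bellman Γ p r β v s - bellman Γ p r β w s| ≤ β * K := by
  obtain ⟨a, ha⟩ := h.argmax_nonempty hv hvb s
  obtain ⟨b, hb⟩ := h.argmax_nonempty hw hwb s
  rw [bellman_eq ha, bellman_eq hb]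
  have hq := abs_lookahead_sub_le (p := p) (r := r) h.pos.le hv.measurable hw.measurable hvb hwb hK
  have h₁ := abs_le.1 (hq (s, a))
  have h₂ := abs_le.1 (hq (s, b))
  have h₃ := hb.2 a ha.1
  have h₄ := ha.2 b hb.1
  exact abs_le.2 ⟨by linarith, by linarith⟩

theorem isRegular_bellman (h : IsSupermodularProgram Γ p r β) [OpensMeasurableSpace S] {v : S → ℝ}
    (hv : IsRegular v) : IsRegular (bellman Γ p r β v) where
  usc := by
    refine upperSemicontinuous_iff_isClosed_preimage.2 fun c => ?_
    have hq := upperSemicontinuous_lookahead h.pos.le h.usc h.usc_kernel hv.usc hv.bounded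
    convert isClosed_setOf_exists_mem h.uhc h.isCompact (hq.isClosed_preimage c) using 1
    ext s
    obtain ⟨a, ha⟩ := h.argmax_nonempty hv.usc hv.bounded s
    change c ≤ bellman Γ p r β v s ↔ ∃ b ∈ Γ s, c ≤ lookahead p r β v (s, b)
    rw [bellman_eq ha]
    exact ⟨fun hc => ⟨a, ha.1, hc⟩, fun ⟨b, hb, hc⟩ => hc.trans (ha.2 b hb)⟩
  bounded := by
    obtain ⟨M, hM⟩ := h.bounded.lookahead (p := p) (β := β) hv.bounded
    refine ⟨M, fun s => ?_⟩
    obtain ⟨a, ha⟩ := h.argmax_nonempty hv.usc hv.bounded s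
    rw [bellman_eq ha]
    exact hM _
  supermodular s t := by
    obtain ⟨a, ha⟩ := h.argmax_nonempty hv.usc hv.bounded s
    obtain ⟨b, hb⟩ := h.argmax_nonempty hv.usc hv.bounded t
    obtain ⟨c, hc⟩ := h.argmax_nonempty hv.usc hv.bounded (s ⊔ t)
    obtain ⟨d, hd⟩ := h.argmax_nonempty hv.usc hv.bounded (s ⊓ t)
    rw [bellman_eq ha, bellman_eq hb, bellman_eq hc, bellman_eq hd]
    obtain ⟨hsup, hinf⟩ := h.supermodular_corr s t a ha.1 b hb.1
    have h₁ := hc.2 _ hsup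
    have h₂ := hd.2 _ hinf
    have h₃ := h.supermodular (s, a) (t, b)
    have h₄ := mul_le_mul_of_nonneg_left
      (h.supermodular_kernel v hv.usc.measurable hv.bounded hv.supermodular (s, a) (t, b)) h.pos.le
    have h₅ : lookahead p r β v (s, a) + lookahead p r β v (t, b) ≤
        lookahead p r β v (s ⊔ t, a ⊔ b) + lookahead p r β v (s ⊓ t, a ⊓ b) := by
      unfold lookahead
      simp only [Prod.mk_sup_mk, Prod.mk_inf_mk] at h₃ h₄
      linarith
    linarith

theorem exists_isRegular_fixedPoint (h : IsSupermodularProgram Γ p r β)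
    [OpensMeasurableSpace S] : ∃ v, IsRegular v ∧ bellman Γ p r β v = v := by
  set T := bellman Γ p r β
  have hreg (n : ℕ) : IsRegular (T^[n] 0) := by
    induction n with
    | zero =>
      exact ⟨upperSemicontinuous_const, ⟨0, by simp⟩, fun _ _ => by simp⟩
    | succ n ih => rw [Function.iterate_succ_apply']; exact h.isRegular_bellman ih
  obtain ⟨M, hM⟩ := (hreg 1).bounded
  have hstep (n : ℕ) (s : S) : dist (T^[n] 0 s) (T^[n + 1] 0 s) ≤ M * β ^ n := by
    induction n generalizing s with
    | zero => simpa [dist_eq_norm] using hM s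
    | succ n ih =>
      rw [Function.iterate_succ_apply', Function.iterate_succ_apply' T (n + 1), Real.dist_eq]
      refine (h.abs_bellman_sub_le (hreg n).usc (hreg (n + 1)).usc (hreg n).bounded
        (hreg (n + 1)).bounded ih s).trans_eq ?_
      ring
  choose v hv using fun s => cauchySeq_tendsto_of_complete
    (cauchySeq_of_le_geometric β M h.lt_one fun n => hstep n s)
  have hdist (n : ℕ) (s : S) : |T^[n] 0 s - v s| ≤ M * β ^ n / (1 - β) :=
    dist_le_of_le_geometric_of_tendsto β M h.lt_one (fun n => hstep n s) (hv s) n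
  have hzero : Filter.Tendsto (fun n : ℕ => M * β ^ n / (1 - β)) Filter.atTop (nhds 0) := by
    simpa using ((tendsto_pow_atTop_nhds_zero_of_lt_one h.pos.le h.lt_one).const_mul M).div_const
      (1 - β)
  have hvr := IsRegular.of_uniform_limit hreg hzero hdist
  -- The shifted iterates converge to `v`, and by the contraction estimate also to `T v`.
  refine ⟨v, hvr, funext fun s => tendsto_nhds_unique ?_ ((Filter.tendsto_add_atTop_iff_nat 1).2
    (hv s))⟩
  refine tendsto_iff_norm_sub_tendsto_zero.2 (squeeze_zero (fun _ => norm_nonneg _) (fun n => ?_)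
    (by simpa using hzero.const_mul β))
  rw [Function.iterate_succ_apply']
  exact h.abs_bellman_sub_le (hreg n).usc hvr.usc (hreg n).bounded hvr.bounded (hdist n) s

end IsSupermodularProgram

end Bellman

/-! ### Expected payoffs of strategies and verification of the fixed point -/

section Payoff

variable {S A : Type*} [MeasurableSpace S] [MeasurableSpace A] {Γ : S → Set A}

instance (p : Kernel (S × A) S) [IsMarkovKernel p] (σ : Strategy Γ) (s : S) :
    IsProbabilityMeasure (σ.law p s) := by
  unfold Strategy.law
  infer_instance

theorem Strategy.integral_stepKernel (p : Kernel (S × A) S) [IsMarkovKernel p] (σ : Strategy Γ)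
    (t : ℕ) (x : Finset.Iic t → S × A) {F : S × A → ℝ} (hF : Measurable F) :
    ∫ y, F y ∂(σ.stepKernel p t x) =
      ∫ s', F (σ.nextPair t (x, s')) ∂(p (x ⟨t, Finset.mem_Iic.2 le_rfl⟩)) := by
  rw [Strategy.stepKernel, Kernel.map_apply _ (σ.measurable_nextPair t),
    integral_map (σ.measurable_nextPair t).aemeasurable hF.aestronglyMeasurable,
    Kernel.prod_apply, Kernel.id_apply, Measure.dirac_prod, Kernel.comap_apply,
    integral_map (by fun_prop) (Measurable.aestronglyMeasurable ?_)]
  exact hF.comp (σ.measurable_nextPair t)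

/-- The joint law of the past and the next pair is the composition product of the law of the past
with `stepKernel`. -/
theorem Strategy.integral_law_succ (p : Kernel (S × A) S) [IsMarkovKernel p] (σ : Strategy Γ)
    (s : S) (t : ℕ) {F : S × A → ℝ} (hF : Measurable F) (hb : IsBoundedFun F) :
    ∫ ω, F (ω (t + 1)) ∂(σ.law p s) =
      ∫ ω, ∫ s', F (σ.nextPair t (Preorder.frestrictLe t ω, s')) ∂(p (ω t)) ∂(σ.law p s) := by
  have hmap := Kernel.partialTraj_compProd_eq_map_traj (X := fun _ : ℕ => S × A)
    (κ := fun t => σ.stepKernel p t) (Nat.zero_le t) (x₀ := fun _ => (s, σ.act 0 (Fin.elim0, s)))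
  have hF' : Measurable fun z : (Finset.Iic t → S × A) × (S × A) => F z.2 := hF.comp measurable_snd
  have h₁ : ∫ ω, F (ω (t + 1)) ∂(σ.law p s) = ∫ z, F z.2 ∂((σ.law p s).map
      fun ω => (Preorder.frestrictLe t ω, ω (t + 1))) := by
    rw [integral_map (by fun_prop) hF'.aestronglyMeasurable]
  rw [h₁, Strategy.law, ← hmap, Measure.integral_compProd
    (integrable_of_isBoundedFun hF' (hb.imp fun M hM z => hM z.2)),
    ← Kernel.traj_map_frestrictLe_apply, integral_map (by fun_prop)]
  · simp only [σ.integral_stepKernel p _ _ hF]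
    rfl
  · exact (hF'.stronglyMeasurable.integral_kernel_prod_right'
      (κ := σ.stepKernel p t)).aestronglyMeasurable

theorem Strategy.integral_law_zero (p : Kernel (S × A) S) [IsMarkovKernel p] (σ : Strategy Γ)
    (s : S) {F : S × A → ℝ} (hF : Measurable F) :
    ∫ ω, F (ω 0) ∂(σ.law p s) = F (s, σ.act 0 (Fin.elim0, s)) := by
  rw [Strategy.law, Kernel.integral_traj]
  · simp [Function.updateFinset]
  · exact (hF.comp (measurable_pi_apply 0)).aestronglyMeasurable

/-- A pointwise comparison along all histories passes to expectations. -/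
theorem Strategy.integral_law_mono (p : Kernel (S × A) S) [IsMarkovKernel p] (σ : Strategy Γ)
    (s : S) {F G : S × A → ℝ} (hF : Measurable F) (hG : Measurable G) (hFb : IsBoundedFun F)
    (hGb : IsBoundedFun G)
    (h : ∀ t (η : History S A t), F (η.2, σ.act t η) ≤ G (η.2, σ.act t η)) (t : ℕ) :
    ∫ ω, F (ω t) ∂(σ.law p s) ≤ ∫ ω, G (ω t) ∂(σ.law p s) := by
  cases t with
  | zero =>
    rw [σ.integral_law_zero p s hF, σ.integral_law_zero p s hG]
    exact h 0 (Fin.elim0, s)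
  | succ t =>
    have hint {H : S × A → ℝ} (hH : Measurable H) (hHb : IsBoundedFun H) :
        Integrable (fun ω => ∫ s', H (σ.nextPair t (Preorder.frestrictLe t ω, s')) ∂(p (ω t)))
          (σ.law p s) := by
      refine integrable_of_isBoundedFun ?_ ?_
      · have h₁ : Measurable fun z : (ℕ → S × A) × S =>
            H (σ.nextPair t (Preorder.frestrictLe t z.1, z.2)) := by
          refine hH.comp ((σ.measurable_nextPair t).comp ?_)
          fun_prop
        exact (h₁.stronglyMeasurable.integral_kernel_prod_right'
          (κ := p.comap (fun ω : ℕ → S × A => ω t) (measurable_pi_apply t))).measurable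
      · exact hHb.imp fun M hM ω => abs_integral_le_of_abs_le (μ := p (ω t)) fun s' => hM _
    -- In this form the next pair is literally one prescribed by `σ`, so `h`, which covers only such
    -- pairs, applies pointwise.
    rw [σ.integral_law_succ p s t hF hFb, σ.integral_law_succ p s t hG hGb]
    refine integral_mono (hint hF hFb) (hint hG hGb) fun ω => ?_
    have hn {H : S × A → ℝ} (hH : Measurable H) (hHb : IsBoundedFun H) :
        Integrable (fun s' => H (σ.nextPair t (Preorder.frestrictLe t ω, s'))) (p (ω t)) :=
      integrable_of_isBoundedFun
        (hH.comp ((σ.measurable_nextPair t).comp measurable_prodMk_left))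
        (hHb.imp fun M hM s' => hM _)
    exact integral_mono (hn hF hFb) (hn hG hGb) fun s' => h (t + 1) (_, s')

theorem Strategy.hasSum_payoff (p : Kernel (S × A) S) [IsMarkovKernel p] {r : S × A → ℝ} {β : ℝ}
    (hβ : 0 ≤ β) (hβ₁ : β < 1) (hr : Measurable r) (hb : IsBoundedFun r) (σ : Strategy Γ) (s : S) :
    HasSum (fun t : ℕ => β ^ t * ∫ ω, r (ω t) ∂(σ.law p s)) (σ.payoff p r β s) := by
  obtain ⟨M, hM⟩ := hb
  have hint (t : ℕ) : Integrable (fun ω : ℕ → S × A => r (ω t)) (σ.law p s) :=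
    integrable_of_isBoundedFun (hr.comp (measurable_pi_apply t)) ⟨M, fun _ => hM _⟩
  have h := hasSum_integral_of_summable_integral_norm (μ := σ.law p s)
    (F := fun t (ω : ℕ → S × A) => β ^ t * r (ω t)) (fun t => (hint t).const_mul _) ?_
  · simp only [integral_const_mul] at h
    exact h
  · refine Summable.of_norm_bounded ((summable_geometric_of_lt_one hβ hβ₁).mul_right M) fun t => ?_
    refine abs_integral_le_of_abs_le fun ω => ?_
    rw [Real.norm_eq_abs, abs_abs, abs_mul, abs_of_nonneg (pow_nonneg hβ t)]
    exact mul_le_mul_of_nonneg_left (hM _) (pow_nonneg hβ t)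

theorem measurable_lookahead {p : Kernel (S × A) S} [IsMarkovKernel p] {r : S × A → ℝ} {β : ℝ}
    {v : S → ℝ} (hr : Measurable r) (hv : Measurable v) : Measurable (lookahead p r β v) :=
  hr.add (hv.stronglyMeasurable.integral_kernel.measurable.const_mul β)

theorem Strategy.integral_lookahead (p : Kernel (S × A) S) [IsMarkovKernel p] {r : S × A → ℝ}
    {β : ℝ} (hr : Measurable r) (hb : IsBoundedFun r) {v : S → ℝ} (hv : Measurable v)
    (hvb : IsBoundedFun v) (σ : Strategy Γ) (s : S) (t : ℕ) :
    ∫ ω, lookahead p r β v (ω t) ∂(σ.law p s) =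
      ∫ ω, r (ω t) ∂(σ.law p s) + β * ∫ ω, v (ω (t + 1)).1 ∂(σ.law p s) := by
  have h : ∫ ω, v (ω (t + 1)).1 ∂(σ.law p s) = ∫ ω, ∫ s', v s' ∂(p (ω t)) ∂(σ.law p s) :=
    σ.integral_law_succ p s t (F := fun x => v x.1) (hv.comp measurable_fst)
      (hvb.imp fun _ hM _ => hM _)
  have hm : Measurable fun x : S × A => ∫ s', v s' ∂(p x) :=
    hv.stronglyMeasurable.integral_kernel.measurable
  rw [h, ← integral_const_mul, ← integral_add]
  · rfl
  · exact integrable_of_isBoundedFun (hr.comp (measurable_pi_apply t)) (hb.imp fun _ hM _ => hM _)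
  · exact (integrable_of_isBoundedFun (hm.comp (measurable_pi_apply t))
      ((hvb.measure_integral (κ := p)).imp fun _ hM _ => hM _)).const_mul β

/-- The discounted expected one-step losses of the function `v` add up to its initial value. -/
theorem Strategy.hasSum_integral_sub (p : Kernel (S × A) S) [IsMarkovKernel p] {β : ℝ}
    (hβ : 0 ≤ β) (hβ₁ : β < 1) {v : S → ℝ} (hv : Measurable v) (hvb : IsBoundedFun v)
    (σ : Strategy Γ) (s : S) :
    HasSum (fun t : ℕ => β ^ t * (∫ ω, v (ω t).1 ∂(σ.law p s) -
      β * ∫ ω, v (ω (t + 1)).1 ∂(σ.law p s))) (v s) := by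
  have hsum := (σ.hasSum_payoff p (r := fun x => v x.1) hβ hβ₁ (hv.comp measurable_fst)
    (hvb.imp fun _ hM _ => hM _) s)
  -- Subtracting the tail of the discounted series from the whole leaves the term at time `0`, which
  -- is `v s`.
  have h := hsum.sub ((hasSum_nat_add_iff' 1).2 hsum)
  rw [Finset.sum_range_one, sub_sub_cancel, pow_zero, one_mul,
    σ.integral_law_zero p s (F := fun x => v x.1) (hv.comp measurable_fst)] at h
  have heq (t : ℕ) : β ^ t * (∫ ω, v (ω t).1 ∂(σ.law p s) -
      β * ∫ ω, v (ω (t + 1)).1 ∂(σ.law p s)) = β ^ t * ∫ ω, v (ω t).1 ∂(σ.law p s) -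
      β ^ (t + 1) * ∫ ω, v (ω (t + 1)).1 ∂(σ.law p s) := by
    ring
  simp only [heq]
  exact h

/-- In expectation the hypothesis bounds the period reward by the one-step loss of `v`; discounting
and summing telescopes to `v s`. -/
theorem Strategy.payoff_le (p : Kernel (S × A) S) [IsMarkovKernel p] {r : S × A → ℝ} {β : ℝ}
    (hβ : 0 ≤ β) (hβ₁ : β < 1) (hr : Measurable r) (hb : IsBoundedFun r) {v : S → ℝ}
    (hv : Measurable v) (hvb : IsBoundedFun v) (σ : Strategy Γ)
    (h : ∀ t (η : History S A t), lookahead p r β v (η.2, σ.act t η) ≤ v η.2) (s : S) :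
    σ.payoff p r β s ≤ v s := by
  refine hasSum_le (fun t => mul_le_mul_of_nonneg_left ?_ (pow_nonneg hβ t))
    (σ.hasSum_payoff p hβ hβ₁ hr hb s) (σ.hasSum_integral_sub p hβ hβ₁ hv hvb s)
  have := σ.integral_law_mono p s (measurable_lookahead hr hv) (G := fun x => v x.1)
    (hv.comp measurable_fst) (hb.lookahead (β := β) hvb) (hvb.imp fun _ hM _ => hM _) h t
  rw [σ.integral_lookahead p hr hb hv hvb] at this
  linarith

theorem Strategy.le_payoff (p : Kernel (S × A) S) [IsMarkovKernel p] {r : S × A → ℝ} {β : ℝ}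
    (hβ : 0 ≤ β) (hβ₁ : β < 1) (hr : Measurable r) (hb : IsBoundedFun r) {v : S → ℝ}
    (hv : Measurable v) (hvb : IsBoundedFun v) (σ : Strategy Γ)
    (h : ∀ t (η : History S A t), v η.2 ≤ lookahead p r β v (η.2, σ.act t η)) (s : S) :
    v s ≤ σ.payoff p r β s := by
  refine hasSum_le (fun t => mul_le_mul_of_nonneg_left ?_ (pow_nonneg hβ t))
    (σ.hasSum_integral_sub p hβ hβ₁ hv hvb s) (σ.hasSum_payoff p hβ hβ₁ hr hb s)
  have := σ.integral_law_mono p s (F := fun x => v x.1) (hv.comp measurable_fst)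
    (measurable_lookahead hr hv) (hvb.imp fun _ hM _ => hM _) (hb.lookahead (β := β) hvb) h t
  rw [σ.integral_lookahead p hr hb hv hvb] at this
  linarith

/-- The stationary strategy which plays the action `f s` in the state `s`. -/
def Strategy.stationary (f : S → A) (hf : Measurable f) (hΓ : ∀ s, f s ∈ Γ s) : Strategy Γ where
  act _ η := f η.2
  measurable_act _ := hf.comp measurable_snd
  feasible _ η := hΓ η.2

end Payoff

end DynProg

theorem mainTheorem6 {n k : ℕ} (S : Sublattice (Fin n → ℝ)) (A : Sublattice (Fin k → ℝ))
    (Γ : S → Set A) (p : Kernel (S × A) S) [IsMarkovKernel p] (r : S × A → ℝ) (β : ℝ)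
    (hβ_pos : 0 < β) (hβ_lt_one : β < 1)
    (hr_bdd : DynProg.IsBoundedFun r) (hr_usc : UpperSemicontinuous r)
    (hp_usc : DynProg.IsUSCKernel p) (hΓ_usc : UpperHemicontinuous Γ)
    (hΓ_nonempty : ∀ s, (Γ s).Nonempty) (hΓ_compact : ∀ s, IsCompact (Γ s))
    (hr : DynProg.IsSupermodular r) (hp : DynProg.IsSupermodularKernel p)
    (hΓ : DynProg.IsSupermodularCorrespondence Γ) :
    (∀ s : S, IsLUB (Set.range fun σ : DynProg.Strategy Γ => σ.payoff p r β s)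
      (DynProg.valueFunction Γ p r β s)) ∧
    DynProg.IsSupermodular (DynProg.valueFunction Γ p r β) := by

  have h : DynProg.IsSupermodularProgram Γ p r β := ⟨hβ_pos, hβ_lt_one, hr_bdd, hr_usc, hp_usc,
    hΓ_usc, hΓ_nonempty, hΓ_compact, hr, hp, hΓ⟩
  obtain ⟨v, hv, hfix⟩ := h.exists_isRegular_fixedPoint
  have hvm : Measurable v := hv.usc.measurable
  have hrm : Measurable r := hr_usc.measurable
  obtain ⟨f, hfm, hf⟩ := ((DynProg.IsMeasurableCompact.of_upperHemicontinuous hΓ_usc hΓ_nonempty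
    hΓ_compact).argmax (DynProg.upperSemicontinuous_lookahead hβ_pos.le hr_usc hp_usc hv.usc
      hv.bounded)).exists_measurable_selector
  have hvf (s : S) : v s = DynProg.lookahead p r β v (s, f s) := by
    rw [← DynProg.bellman_eq (hf s), hfix]
  have hgreatest (s : S) : IsGreatest
      (Set.range fun σ : DynProg.Strategy Γ => σ.payoff p r β s) (v s) := by
    have hle (σ : DynProg.Strategy Γ) : σ.payoff p r β s ≤ v s :=
      -- After any history the prescribed action is feasible, hence no better than the maximizer
      -- `f`.
      σ.payoff_le p hβ_pos.le hβ_lt_one hrm hr_bdd hvm hv.bounded (fun t η => by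
        rw [hvf η.2]
        exact (hf η.2).2 _ (σ.feasible t η)) s
    refine ⟨⟨DynProg.Strategy.stationary f hfm fun s => (hf s).1, ?_⟩, ?_⟩
    · exact le_antisymm (hle _) (DynProg.Strategy.le_payoff p hβ_pos.le hβ_lt_one hrm hr_bdd hvm
        hv.bounded _ (fun _ η => (hvf η.2).le) s)
    · rintro _ ⟨σ, rfl⟩
      exact hle σ
  have hval : DynProg.valueFunction Γ p r β = v := funext fun s => (hgreatest s).csSup_eq
  rw [hval]
  exact ⟨fun s => (hgreatest s).isLUB, hv.supermodular⟩
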